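/- **Theorem.** For $\delta\in[0,1]$, call a map $Q:\mathbb R^d\to\mathbb R^d$ a $\delta$-compressor (for unit vectors) if $\|Q(v)-v\|_2^2\le 1-\delta$ for every $v$ with $\|v\|_2=1$; a randomized $Q$ is a $\delta$-compressor if $\mathbb E\|Q(v)-v\|_2^2\le 1-\delta$ for every such $v$. Let $a_1,\dots,a_n\in\mathbb R^d$ be independent standard Gaussian vectors, let $N=d/\delta$, and let $\mathcal Q(v)$ be a codeword nearest to $v$ in the codebook $\{a_1/\sqrt N,\dots,a_n/\sqrt N\}$, so that $\mathcal Q(v)$ is described by its index. For $t>0$ put $$P_\delta(d,n,t)=1-\exp\!\left[-\frac{n}{2\sqrt{2\pi}\,(2+t)\sqrt{d\delta}}\;e^{-(2+t)^2d\delta/8}+\frac{2d}{\sqrt{1-\delta}}\right].$$ Fix constants $t>0$ and $K>0$, and call $(d,\delta)$ admissible if $0<\delta<1$, $(2+t)^2\delta<t^2$ and $\log d\le K\,d\delta$. 1. There is $d_0=d_0(t,K)$ such that for all admissible $(d,\delta)$ with $d\ge d_0$ and all $n\ge1$, the map $\mathcal Q$ is a $\delta$-compressor with probability at least $P_\delta(d,n,t)$.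 2. There is $C=C(t,K)>0$ such that $n=\exp(O(d\delta))$ codewords, that is $b=\lceil\log_2 n\rceil=O(d\delta)$ bits, give $P_\delta=1-o(1)$: for every $\eta>0$ there is $d_0=d_0(t,K,\eta)$ such that, for all admissible $(d,\delta)$ with $d\ge d_0$, we have $P_\delta(d,n,t)\ge 1-\eta$ for every $n\ge e^{Cd\delta}$, and $\lceil\log_2 n\rceil\le 2C\,d\delta$ for $n=\lceil e^{Cd\delta}\rceil$. 3. The order $d\delta$ of the number of bits is optimal: for all $d$ and all $\delta\in[0,1]$, if a (possibly randomized) $\delta$-compressor $Q$ has, for every unit vector $v$, its output $Q(v)$ almost surely in a fixed finite set $S\subset\mathbb R^d$, then $\log_2|S|\ge d\delta/2$. -/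

import Mathlib

open MeasureTheory ProbabilityTheory

noncomputable section

namespace GaussCode

/-- `ℝ^d` with its Euclidean norm. -/
abbrev Vec (d : ℕ) : Type := EuclideanSpace ℝ (Fin d)

/-- A (deterministic) operator on `ℝ^d` is a `δ`-compressor for unit vectors if
`‖Q(v) - v‖² ≤ 1 - δ` for every unit vector `v`. -/
def IsCompressor {d : ℕ} (δ : ℝ) (Q : Vec d → Vec d) : Prop :=
  ∀ v : Vec d, ‖v‖ = 1 → ‖Q v - v‖ ^ 2 ≤ 1 - δ

/-- A randomized operator `Q` on `ℝ^d`, with randomness `ω` of law `μ`, is a `δ`-compressor for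
unit vectors if `𝔼 ‖Q(v) - v‖² ≤ 1 - δ` (a finite expectation) for every unit vector `v`. -/
def IsRandomizedCompressor {d : ℕ} {Ω : Type*} [MeasurableSpace Ω] (μ : Measure Ω) (δ : ℝ)
    (Q : Ω → Vec d → Vec d) : Prop :=
  ∀ v : Vec d, ‖v‖ = 1 →
    Integrable (fun ω => ‖Q ω v - v‖ ^ 2) μ ∧ ∫ ω, ‖Q ω v - v‖ ^ 2 ∂μ ≤ 1 - δ

/-- For an operator that does not depend on the randomness the two notions agree. -/
theorem isRandomizedCompressor_const {d : ℕ} {Ω : Type*} [MeasurableSpace Ω] (μ : Measure Ω)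
    [IsProbabilityMeasure μ] (δ : ℝ) (Q : Vec d → Vec d) :
    IsRandomizedCompressor μ δ (fun _ => Q) ↔ IsCompressor δ Q := by
  simp [IsRandomizedCompressor, IsCompressor]

/-- The joint law of `n` independent standard Gaussian vectors `a 0, …, a (n - 1)` of `ℝ^d`:
all entries `a j i` are independent with law `N(0, 1)`. -/
def gaussianLaw (d n : ℕ) : Measure (Fin n → Fin d → ℝ) :=
  Measure.pi fun _ : Fin n => Measure.pi fun _ : Fin d => gaussianReal 0 1

/-- The codebook with codewords `a j / √N`. -/
def codebook {d n : ℕ} (N : ℝ) (a : Fin n → Fin d → ℝ) : Fin n → Vec d :=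
  fun j => (1 / Real.sqrt N) • (WithLp.toLp 2 (a j) : Vec d)

theorem exists_nearest {d n : ℕ} [NeZero n] (c : Fin n → Vec d) (v : Vec d) :
    ∃ i : Fin n, ∀ j : Fin n, ‖v - c i‖ ^ 2 ≤ ‖v - c j‖ ^ 2 :=
  Finite.exists_min fun i => ‖v - c i‖ ^ 2

/-- The encoder: the index of a codeword nearest to `v`. -/
def encode {d n : ℕ} [NeZero n] (c : Fin n → Vec d) (v : Vec d) : Fin n :=
  (exists_nearest c v).choose

/-- Nearest-codeword quantization: the codeword whose index is transmitted. -/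
def quantize {d n : ℕ} [NeZero n] (c : Fin n → Vec d) (v : Vec d) : Vec d :=
  c (encode c v)

/-- The probability bound
`P_δ = 1 - exp(-n e^{-(2+t)² dδ/8} / (2 √(2π) (2+t) √(dδ)) + 2d/√(1-δ))`. -/
def probBound (d n : ℕ) (δ t : ℝ) : ℝ :=
  1 - Real.exp
    (-(n / (2 * Real.sqrt (2 * Real.pi) * (2 + t) * Real.sqrt (d * δ))
        * Real.exp (-((2 + t) ^ 2 * (d * δ) / 8)))
      + 2 * d / Real.sqrt (1 - δ))

/-- The range of parameters, for constants `t` and `K`: `0 < δ < 1`, `(2+t)² δ < t²`, and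
`log d ≤ K d δ`. -/
def Admissible (t K : ℝ) (d : ℕ) (δ : ℝ) : Prop :=
  0 < δ ∧ δ < 1 ∧ (2 + t) ^ 2 * δ < t ^ 2 ∧ Real.log d ≤ K * (d * δ)

end GaussCode

end

namespace GaussCode

/-! Upper bound. For a fixed unit vector u, a scaled Gaussian codeword lies within √(1-δ) - 1/d of u
with probability at least e^{-(2+t)²dδ/8} times a factor of order log d (`exists_le_stdPi_near`).
The margin 1/d is spent on a net of at most (2d²+1)^d points, and the logarithmic factor pays for
the union bound over it.

The estimate for one vector rests on one fact: translating a symmetric set by z costs at most a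
factor e^{-‖z‖²/2} in Gaussian measure (`exp_mul_stdPi_le_stdPi_translate`). For δ ≤ 4/9 the set
consists of typical vectors, of norm at most about √d and with bounded component along u, and it is
shifted by (1+w)√(dδ) u with w < t/2; the gap between (1+w)²/2 and (2+t)²/8 is a gain exponential in
dδ. For δ > 1/2 no such shift suffices, so for δ ≥ 4/9 a cube centred at √N u is used instead:
(2+t)²δ < t² then forces t to be so large that this crude bound wins. As log d ≤ K dδ, the
exponential gain absorbs log d.

Lower bound. For each v a randomized compressor takes some value in S with error at most the mean,
so caps around the points of S cover the sphere. The cone over each cap lies in a ball of radius ρ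
with ρ² ≤ 2^{-δ}; these balls cover the unit ball, and volumes give |S| ≥ ρ^{-d} ≥ 2^{dδ/2}. -/

/-! ### Gaussian measure of translated sets -/

/-- The law of a standard Gaussian vector of `ℝ^d`, as a product measure. -/
noncomputable abbrev stdPi (d : ℕ) : Measure (Fin d → ℝ) := Measure.pi fun _ : Fin d => gaussianReal 0 1

theorem gaussianReal_eq_withDensity_exp (w : ℝ) :
    gaussianReal w 1 =
      (gaussianReal 0 1).withDensity fun x => ENNReal.ofReal (Real.exp (w * x - w ^ 2 / 2)) := by
  rw [gaussianReal_of_var_ne_zero w one_ne_zero, gaussianReal_of_var_ne_zero 0 one_ne_zero,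
    ← withDensity_mul _ (measurable_gaussianPDF 0 1) (by fun_prop)]
  congr 1
  ext x
  simp only [Pi.mul_apply, gaussianPDF_def, gaussianPDFReal_def]
  rw [← ENNReal.ofReal_mul (by positivity), mul_assoc (_⁻¹), ← Real.exp_add]
  congr 3
  norm_num
  ring

theorem pi_withDensity {ι : Type*} [Fintype ι] {X : ι → Type*} [∀ i, MeasurableSpace (X i)]
    (μ : ∀ i, Measure (X i)) [∀ i, IsProbabilityMeasure (μ i)] (f : ∀ i, X i → ENNReal)
    (hf : ∀ i, Measurable (f i)) [∀ i, SigmaFinite ((μ i).withDensity (f i))] :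
    Measure.pi (fun i => (μ i).withDensity (f i)) =
      (Measure.pi μ).withDensity fun x => ∏ i, f i (x i) := by
  refine Measure.pi_eq fun s hs => ?_
  rw [withDensity_apply _ (MeasurableSet.univ_pi hs),
    ← lintegral_indicator (MeasurableSet.univ_pi hs)]
  have h1 : ∀ x : ∀ i, X i, (Set.univ.pi s).indicator (fun x => ∏ i, f i (x i)) x =
      ∏ i, (s i).indicator (f i) (x i) := by
    intro x
    by_cases hx : x ∈ Set.univ.pi s
    · rw [Set.indicator_of_mem hx]
      exact Finset.prod_congr rfl fun i _ => (Set.indicator_of_mem (hx i trivial) _).symm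
    · rw [Set.indicator_of_notMem hx]
      obtain ⟨i, hi⟩ : ∃ i, x i ∉ s i := by simpa [Set.mem_pi] using hx
      exact (Finset.prod_eq_zero (Finset.mem_univ i) (Set.indicator_of_notMem hi _)).symm
  have hm : ∀ i, Measurable ((s i).indicator (f i)) := fun i => (hf i).indicator (hs i)
  simp_rw [h1]
  refine (lintegral_prod_eq_prod_lintegral_of_indepFun Finset.univ
    (fun i (x : ∀ i, X i) => (s i).indicator (f i) (x i))
    (iIndepFun_pi fun i => (hm i).aemeasurable)
    fun i => (hm i).comp (measurable_pi_apply i)).trans ?_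
  refine Finset.prod_congr rfl fun i _ => ?_
  rw [withDensity_apply _ (hs i), ← lintegral_indicator (hs i),
    (measurePreserving_eval μ i).lintegral_comp (hm i)]

/-- The Cameron–Martin formula for the standard Gaussian law. -/
theorem stdPi_preimage_add {d : ℕ} (w : Fin d → ℝ) {A : Set (Fin d → ℝ)} (hA : MeasurableSet A) :
    stdPi d {x | x + w ∈ A} =
      ∫⁻ x in A, ENNReal.ofReal (Real.exp (∑ i, w i * x i - (∑ i, w i ^ 2) / 2)) ∂stdPi d := by
  have h1 : (stdPi d).map (fun x i => x i + w i) = Measure.pi fun i => gaussianReal (w i) 1 := by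
    have := Measure.pi_map_pi (μ := fun _ : Fin d => gaussianReal 0 1)
      (f := fun i x => x + w i) (fun i => by fun_prop)
    rw [this]
    simp [gaussianReal_map_add_const]
  have h2 : (Measure.pi fun i => gaussianReal (w i) 1) = (stdPi d).withDensity
      fun x => ∏ i, ENNReal.ofReal (Real.exp (w i * x i - w i ^ 2 / 2)) := by
    have hσ : ∀ i, SigmaFinite ((gaussianReal 0 1).withDensity
        fun x => ENNReal.ofReal (Real.exp (w i * x - w i ^ 2 / 2))) := fun i => by
      rw [← gaussianReal_eq_withDensity_exp]; infer_instance
    rw [← pi_withDensity (fun _ : Fin d => gaussianReal 0 1)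
      (fun i x => ENNReal.ofReal (Real.exp (w i * x - w i ^ 2 / 2))) (fun i => by fun_prop)]
    simp_rw [← gaussianReal_eq_withDensity_exp]
  have h3 : stdPi d {x | x + w ∈ A} = (stdPi d).map (fun x i => x i + w i) A := by
    rw [Measure.map_apply (by fun_prop) hA]; rfl
  rw [h3, h1, h2, withDensity_apply _ hA]
  refine lintegral_congr fun x => ?_
  rw [← ENNReal.ofReal_prod_of_nonneg fun i _ => (Real.exp_pos _).le, ← Real.exp_sum,
    Finset.sum_sub_distrib, Finset.sum_div]

theorem stdPi_preimage_neg {d : ℕ} {A : Set (Fin d → ℝ)} (hA : MeasurableSet A) :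
    stdPi d {x | -x ∈ A} = stdPi d A := by
  have h1 : (stdPi d).map (fun x i => -(x i)) = stdPi d := by
    have := Measure.pi_map_pi (μ := fun _ : Fin d => gaussianReal 0 1)
      (f := fun _ x => -x) (fun i => by fun_prop)
    rw [this]
    simp [gaussianReal_map_neg]
  conv_rhs => rw [← h1, Measure.map_apply (by fun_prop) hA]
  rfl

/-- Translating a symmetric set by `w` decreases its Gaussian measure at most by the factor
`e^{-‖w‖²/2}`. -/
theorem exp_mul_stdPi_le_stdPi_translate {d : ℕ} (w : Fin d → ℝ) {A : Set (Fin d → ℝ)}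
    (hA : MeasurableSet A) (hsymm : ∀ x ∈ A, -x ∈ A) :
    Real.exp (-((∑ i, w i ^ 2) / 2)) * (stdPi d).real A ≤ (stdPi d).real {x | x - w ∈ A} := by
  set B := {x | x - w ∈ A}
  have hB : MeasurableSet B := (measurable_id.sub_const w) hA
  have h1 : stdPi d B = ∫⁻ x in A,
      ENNReal.ofReal (Real.exp (-(∑ i, w i * x i) - (∑ i, w i ^ 2) / 2)) ∂stdPi d := by
    have := stdPi_preimage_add (-w) hA
    simpa [B, sub_eq_add_neg] using this
  have h2 : stdPi d B = ∫⁻ x in A,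
      ENNReal.ofReal (Real.exp (∑ i, w i * x i - (∑ i, w i ^ 2) / 2)) ∂stdPi d := by
    rw [← stdPi_preimage_add w hA, ← stdPi_preimage_neg hB]
    congr 1
    ext x
    have hneg : -x - w = -(x + w) := by abel
    simp only [B, Set.mem_ofPred_eq, hneg]
    exact ⟨fun h => by simpa using hsymm _ h, fun h => hsymm _ h⟩
  -- By symmetry of A, the shifts by w and -w give B the same measure; adding the two formulas
  -- produces 2 cosh⟨w, x⟩ ≥ 2 under the integral.
  have h3 : 2 * (ENNReal.ofReal (Real.exp (-((∑ i, w i ^ 2) / 2))) * stdPi d A)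
      ≤ 2 * stdPi d B := by
    rw [two_mul (stdPi d B)]
    nth_rw 1 [h1]
    rw [h2, ← lintegral_add_left (by fun_prop), ← setLIntegral_const, ← lintegral_const_mul _
      (by fun_prop)]
    refine lintegral_mono fun x => ?_
    dsimp only
    rw [← ENNReal.ofReal_add (Real.exp_pos _).le (Real.exp_pos _).le,
      show (2 : ENNReal) = ENNReal.ofReal 2 by simp, ← ENNReal.ofReal_mul zero_le_two]
    refine ENNReal.ofReal_le_ofReal ?_
    set a := ∑ i, w i * x i
    set b := (∑ i, w i ^ 2) / 2
    have hc := Real.one_le_cosh a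
    rw [Real.cosh_eq] at hc
    rw [sub_eq_add_neg, sub_eq_add_neg, Real.exp_add, Real.exp_add]
    nlinarith [Real.exp_pos (-b)]
  have h4 := (ENNReal.mul_le_mul_iff_right two_ne_zero ENNReal.ofNat_ne_top).1 h3
  have h5 := ENNReal.toReal_mono (measure_ne_top _ _) h4
  rwa [ENNReal.toReal_mul, ENNReal.toReal_ofReal (Real.exp_pos _).le] at h5

/-! ### Typical vectors and cubes -/

/-- Chebyshev's inequality for a sum of functions of the coordinates. -/
theorem stdPi_deviation_le {d : ℕ} (f : Fin d → ℝ → ℝ)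
    (hf : ∀ i, MemLp (f i) 2 (gaussianReal 0 1)) {c : ℝ} (hc : 0 < c) :
    (stdPi d).real {x | c ≤ |∑ i, f i (x i) - ∑ i, ∫ y, f i y ∂gaussianReal 0 1|} ≤
      (∑ i, Var[f i; gaussianReal 0 1]) / c ^ 2 := by
  have hf' : ∀ i, MemLp (fun x : Fin d → ℝ => f i (x i)) 2 (stdPi d) := fun i =>
    (hf i).comp_measurePreserving (measurePreserving_eval (fun _ : Fin d => gaussianReal 0 1) i)
  have hsum : MemLp (∑ i, fun x : Fin d → ℝ => f i (x i)) 2 (stdPi d) :=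
    memLp_finsetSum' _ fun i _ => hf' i
  have hint : (stdPi d)[∑ i, fun x : Fin d → ℝ => f i (x i)] =
      ∑ i, ∫ y, f i y ∂gaussianReal 0 1 := by
    simp only [Finset.sum_apply]
    rw [integral_finsetSum _ fun i _ => (hf' i).integrable one_le_two]
    exact Finset.sum_congr rfl fun i _ =>
      integral_comp_eval (μ := fun _ : Fin d => gaussianReal 0 1) (hf i).aestronglyMeasurable
  have h := meas_ge_le_variance_div_sq hsum hc
  rw [hint, variance_sum_pi (μ := fun _ : Fin d => gaussianReal 0 1) hf] at h
  simp only [Finset.sum_apply] at h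
  refine ENNReal.toReal_le_of_le_ofReal ?_ h
  exact div_nonneg (Finset.sum_nonneg fun i _ => variance_nonneg _ _) (sq_nonneg c)

theorem memLp_sq_gaussianReal : MemLp (fun x : ℝ => x ^ 2) 2 (gaussianReal 0 1) := by
  have h := (memLp_id_gaussianReal' (μ := 0) (v := 1) 4 (by simp)).norm_rpow_div 2
  norm_num at h
  convert h using 1
  rw [ENNReal.div_eq_inv_mul, show (4 : ENNReal) = 2 * 2 by norm_num, ← mul_assoc,
    ENNReal.inv_mul_cancel two_ne_zero ENNReal.ofNat_ne_top, one_mul]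

theorem integral_sq_gaussianReal : ∫ x, x ^ 2 ∂gaussianReal 0 1 = 1 := by
  have h := variance_fun_id_gaussianReal (μ := 0) (v := 1)
  rw [variance_of_integral_eq_zero (by fun_prop) (by simp)] at h
  simpa using h

/-- In high dimension a standard Gaussian vector has, with probability at least `1/2`, squared
norm at most `(1 + η) d` and bounded component in a given direction. -/
theorem exists_half_le_stdPi_typical {η : ℝ} (hη : 0 < η) :
    ∃ d₀ : ℕ, ∀ d : ℕ, d₀ ≤ d → ∀ v : Fin d → ℝ, ∑ i, v i ^ 2 = 1 →
      1 / 2 ≤ (stdPi d).real {x | ∑ i, x i ^ 2 ≤ (1 + η) * d ∧ |∑ i, v i * x i| ≤ 2} := by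
  set V := Var[fun x : ℝ => x ^ 2; gaussianReal 0 1]
  obtain ⟨d₀, hd₀⟩ := exists_nat_ge (4 * V / η ^ 2)
  refine ⟨d₀ + 1, fun d hd v hv => ?_⟩
  have hdpos : (0 : ℝ) < d := by exact_mod_cast (Nat.succ_pos d₀).trans_le hd
  have hdV : 4 * V / η ^ 2 ≤ d := hd₀.trans (by exact_mod_cast (Nat.le_succ d₀).trans hd)
  have h1 := stdPi_deviation_le (d := d) (fun _ x => x ^ 2) (fun _ => memLp_sq_gaussianReal)
    (mul_pos hη hdpos)
  have h2 := stdPi_deviation_le (d := d) (fun i x => v i * x)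
    (fun i => (memLp_id_gaussianReal' 2 (by simp)).const_mul (v i)) zero_lt_two
  simp only [integral_sq_gaussianReal, Finset.sum_const, Finset.card_univ, Fintype.card_fin,
    nsmul_eq_mul, mul_one] at h1
  have hint : ∀ i, ∫ y, v i * y ∂gaussianReal 0 1 = 0 := fun i => by
    rw [integral_const_mul, integral_id_gaussianReal, mul_zero]
  have hvar : ∀ i, Var[fun x => v i * x; gaussianReal 0 1] = v i ^ 2 := fun i => by
    rw [variance_const_mul, variance_fun_id_gaussianReal, NNReal.coe_one, mul_one]
  simp only [hint, hvar, Finset.sum_const_zero, sub_zero, hv] at h2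
  -- Each of the two failure events has probability at most 1/4: here the norm; for the component
  -- along v the bound is 1/2².
  have h1' : (d : ℝ) * V / (η * d) ^ 2 ≤ 1 / 4 := by
    rw [div_le_iff₀ (by positivity)] at hdV ⊢
    nlinarith
  have hsub : {x : Fin d → ℝ | ∑ i, x i ^ 2 ≤ (1 + η) * d ∧ |∑ i, v i * x i| ≤ 2}ᶜ ⊆
      {x | η * d ≤ |∑ i, x i ^ 2 - d|} ∪ {x | 2 ≤ |∑ i, v i * x i|} := by
    intro x hx
    simp only [Set.mem_compl_iff, Set.mem_ofPred_eq, not_and_or, not_le] at hx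
    rcases hx with hx | hx
    · exact Or.inl ((by linarith : η * d ≤ ∑ i, x i ^ 2 - d).trans (le_abs_self _))
    · exact Or.inr hx.le
  have hm : MeasurableSet {x : Fin d → ℝ | ∑ i, x i ^ 2 ≤ (1 + η) * d ∧ |∑ i, v i * x i| ≤ 2} := by
    rw [Set.ofPred_and]
    exact (measurableSet_le (by fun_prop) (by fun_prop)).inter
      (measurableSet_le (by fun_prop) (by fun_prop))
  have h3 := (measureReal_mono hsub (μ := stdPi d)).trans (measureReal_union_le _ _)
  rw [probReal_compl_eq_one_sub hm] at h3
  linarith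

/-- The Gaussian measure of a cube. -/
theorem pow_le_stdPi_cube {d : ℕ} {r : ℝ} (hr : 0 ≤ r) :
    (Real.sqrt (2 / Real.pi) * r * Real.exp (-(r ^ 2 / 2))) ^ d ≤
      (stdPi d).real {x | ∀ i, |x i| ≤ r} := by
  have h1 : {x : Fin d → ℝ | ∀ i, |x i| ≤ r} = Set.univ.pi fun _ => Set.Icc (-r) r := by
    ext x; simp only [abs_le, Set.mem_pi, Set.mem_Icc, Set.mem_ofPred_eq, Set.mem_univ, true_imp_iff]
  -- On [-r, r] the Gaussian density is at least its value at r.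
  have h2 : Real.sqrt (2 / Real.pi) * r * Real.exp (-(r ^ 2 / 2)) ≤
      (gaussianReal 0 1).real (Set.Icc (-r) r) := by
    rw [measureReal_def, gaussianReal_apply_eq_integral 0 one_ne_zero, ENNReal.toReal_ofReal
      (setIntegral_nonneg measurableSet_Icc fun x _ => gaussianPDFReal_nonneg _ _ _)]
    have hc : Real.sqrt (2 / Real.pi) * r * Real.exp (-(r ^ 2 / 2)) =
        ∫ x in Set.Icc (-r) r, gaussianPDFReal 0 1 r := by
      rw [setIntegral_const, measureReal_def, Real.volume_Icc, ENNReal.toReal_ofReal (by linarith),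
        gaussianPDFReal_def]
      have : Real.sqrt (2 / Real.pi) = 2 * (Real.sqrt (2 * Real.pi))⁻¹ := by
        rw [← Real.sqrt_inv, show (2 : ℝ) / Real.pi = 2 ^ 2 * (2 * Real.pi)⁻¹ by
          field_simp, Real.sqrt_mul (by norm_num), Real.sqrt_sq (by norm_num)]
      rw [this]
      simp
      ring_nf
    rw [hc]
    refine setIntegral_mono_on (by simp) (integrable_gaussianPDFReal _ _).integrableOn
      measurableSet_Icc fun x hx => ?_
    simp only [gaussianPDFReal_def]
    have : x ^ 2 ≤ r ^ 2 := sq_le_sq.2 (by rw [abs_of_nonneg hr]; exact abs_le.2 hx)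
    simp only [sub_zero]
    gcongr
  rw [h1, measureReal_def, Measure.pi_pi, ENNReal.toReal_prod]
  simp only [Finset.prod_const, Finset.card_univ, Fintype.card_fin]
  exact pow_le_pow_left₀ (by positivity) h2 d

/-! ### Coordinates, and growth in dδ -/

theorem norm_smul_toLp_sub_le {d : ℕ} {N ρ : ℝ} (hN : 0 < N) (hρ : 0 ≤ ρ) (v : Vec d)
    (x : Fin d → ℝ) (h : ∑ i, (x i - Real.sqrt N * v i) ^ 2 ≤ N * ρ ^ 2) :
    ‖(1 / Real.sqrt N) • (WithLp.toLp 2 x : Vec d) - v‖ ≤ ρ := by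
  refine le_of_sq_le_sq ?_ hρ
  have hs := Real.sqrt_pos.2 hN
  rw [EuclideanSpace.real_norm_sq_eq]
  have : ∀ i, ((1 / Real.sqrt N) • (WithLp.toLp 2 x : Vec d) - v) i ^ 2 =
      (x i - Real.sqrt N * v i) ^ 2 / N := fun i => by
    simp only [PiLp.sub_apply, PiLp.smul_apply, smul_eq_mul]
    nth_rw 3 [← Real.sq_sqrt hN.le]
    field_simp
  rw [Finset.sum_congr rfl fun i _ => this i, ← Finset.sum_div, div_le_iff₀ hN]
  linarith

theorem exists_linear_le_exp {a : ℝ} (ha : 0 < a) (b c : ℝ) :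
    ∃ X₀ : ℝ, ∀ X, X₀ ≤ X → b + c * X ≤ Real.exp (a * X) := by
  have h : (fun X : ℝ => b + c * X) =o[Filter.atTop] fun X => Real.exp (a * X) := by
    refine Asymptotics.IsLittleO.add ?_ ?_
    · simpa using isLittleO_pow_exp_pos_mul_atTop 0 ha |>.const_mul_left b
    · simpa using isLittleO_pow_exp_pos_mul_atTop 1 ha |>.const_mul_left c
  obtain ⟨X₀, hX₀⟩ := Filter.eventually_atTop.1 (h.bound one_pos)
  refine ⟨X₀, fun X hX => ?_⟩
  have := hX₀ X hX
  rw [one_mul, Real.norm_of_nonneg (Real.exp_pos _).le] at this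
  exact (le_abs_self _).trans this

/-- Since dδ ≥ log d / K, large d makes dδ large uniformly in δ. -/
theorem Admissible.exists_le_mul {t K : ℝ} (hK : 0 < K) (X₀ : ℝ) :
    ∃ d₀ : ℕ, ∀ d : ℕ, d₀ ≤ d → ∀ δ : ℝ, Admissible t K d δ → X₀ ≤ d * δ := by
  obtain ⟨d₀, hd₀⟩ := exists_nat_ge (Real.exp (K * X₀))
  refine ⟨d₀, fun d hd δ h => ?_⟩
  have h1 : Real.exp (K * X₀) ≤ d := hd₀.trans (by exact_mod_cast hd)
  have h2 := (Real.le_log_iff_exp_le ((Real.exp_pos _).trans_le h1)).2 h1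
  exact le_of_mul_le_mul_left (h2.trans h.2.2.2) hK

theorem log_two_mul_sq_add_one_le {d : ℕ} (hd : 0 < d) :
    Real.log (2 * (d : ℝ) ^ 2 + 1) ≤ 2 + 2 * Real.log d := by
  have h1 : (1 : ℝ) ≤ d := by exact_mod_cast hd
  calc Real.log (2 * (d : ℝ) ^ 2 + 1) ≤ Real.log (3 * (d : ℝ) ^ 2) :=
        Real.log_le_log (by positivity) (by nlinarith)
    _ = Real.log 3 + 2 * Real.log d := by
        rw [Real.log_mul (by norm_num) (by positivity), Real.log_pow]; norm_num
    _ ≤ _ := by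
        have := Real.log_le_sub_one_of_pos (show (0 : ℝ) < 3 by norm_num)
        linarith

/-! ### One vector, δ ≤ 4/9: shifting typical vectors -/

/-- Times d, the left side is the excess of the squared distance to √N v over N(1-δ), for a vector
of squared norm d orthogonal to v, shifted by (1+w)√(dδ) v. For t ≤ 2 the hypothesis bounds δ by
(t/2)²/(1+t/2)²; for t ≥ 2, w = 3/4 and δ ≤ 4/9 give 49/36 - 3/2 < 0. -/
theorem quadratic_slack {t δ w : ℝ} (ht : 0 < t) (hδ0 : 0 < δ) (hδ : δ ≤ 4 / 9)
    (h : (2 + t) ^ 2 * δ < t ^ 2) (hw : w = 3 / 4 * min (t / 2) 1) :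
    (1 + w) ^ 2 * δ - 2 * w ≤ -(w / 8) := by
  rcases le_total (t / 2) 1 with h1 | h1
  · rw [min_eq_left h1] at hw
    have h2 : (1 + t / 2) ^ 2 * δ ≤ (t / 2) ^ 2 := by linarith
    have h3 : (1 + w) ^ 2 ≤ (1 + t / 2) ^ 2 :=
      pow_le_pow_left₀ (by linarith) (by linarith) 2
    have h4 := mul_le_mul_of_nonneg_right h3 hδ0.le
    have h5 : (t / 2) ^ 2 ≤ t / 2 := by nlinarith
    linarith
  · rw [min_eq_right h1] at hw
    rw [hw]; linarith

/-- The first term bounds the cross term of the expanded square, the second is the cost of shrinking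
the radius by 1/D. Both are multiples of D/√(Dδ) at most, with 14 = 12 + 2. -/
theorem sampling_error_le {D δ w : ℝ} (hD : 0 < D) (hδ : 0 < δ) (hw : 0 < w) (h1 : 1 ≤ D * δ)
    (h2 : (14 * 16 / w) ^ 2 ≤ D * δ) : 12 * Real.sqrt (D / δ) + 2 / δ ≤ w / 16 * D := by
  have hX0 : 0 < D * δ := by positivity
  have hX1 : 1 ≤ Real.sqrt (D * δ) := Real.one_le_sqrt.2 h1
  have e1 : Real.sqrt (D / δ) = D / Real.sqrt (D * δ) := by
    rw [eq_div_iff (by positivity), ← Real.sqrt_mul (by positivity),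
      show D / δ * (D * δ) = D ^ 2 by field_simp, Real.sqrt_sq hD.le]
  have e2 : 2 / δ = 2 * D / (D * δ) := by field_simp
  have h3 : 2 * D / (D * δ) ≤ 2 * D / Real.sqrt (D * δ) :=
    div_le_div_of_nonneg_left (by positivity) (by positivity) (by
      nlinarith [Real.sq_sqrt hX0.le])
  have h4 : 14 * D / Real.sqrt (D * δ) ≤ w / 16 * D := by
    have h5 : 14 * 16 / w ≤ Real.sqrt (D * δ) := Real.le_sqrt_of_sq_le h2
    rw [div_le_iff₀ hw] at h5
    rw [div_le_iff₀ (by positivity)]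
    have := mul_le_mul_of_nonneg_left h5 hD.le
    linarith
  rw [e1, e2]
  calc 12 * (D / Real.sqrt (D * δ)) + 2 * D / (D * δ) ≤
        12 * (D / Real.sqrt (D * δ)) + 2 * D / Real.sqrt (D * δ) := by linarith
    _ = 14 * D / Real.sqrt (D * δ) := by ring
    _ ≤ _ := h4

/-- The Gaussian vector `b`, translated by a multiple of `v`, is near `v` after scaling. -/
theorem norm_sub_le_of_typical {d : ℕ} {δ w : ℝ} (hd : 2 ≤ d) (hδ0 : 0 < δ) (hδ : δ ≤ 4 / 9)
    (hw0 : 0 < w) (hw1 : w ≤ 1) (hquad : (1 + w) ^ 2 * δ - 2 * w ≤ -(w / 8))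
    (herr : 12 * Real.sqrt (d / δ) + 2 / δ ≤ w / 16 * d) {v : Vec d} (hv : ∑ i, v i ^ 2 = 1)
    {x b : Fin d → ℝ} (hb : ∀ i, b i = x i - (1 + w) * Real.sqrt (d * δ) * v i)
    (hb1 : ∑ i, b i ^ 2 ≤ (1 + w / 16) * d) (hb2 : |∑ i, v i * b i| ≤ 2) :
    ‖(1 / Real.sqrt ((d : ℝ) / δ)) • (WithLp.toLp 2 x : Vec d) - v‖ ≤
      Real.sqrt (1 - δ) - 1 / d := by
  have hd2 : (2 : ℝ) ≤ d := by exact_mod_cast hd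
  have hd0 : (0 : ℝ) < d := by linarith
  have hN0 : 0 < (d : ℝ) / δ := by positivity
  have hX0 : 0 < (d : ℝ) * δ := by positivity
  have hXN : Real.sqrt (d * δ) * Real.sqrt (d / δ) = d := by
    rw [← Real.sqrt_mul hX0.le, show (d : ℝ) * δ * (d / δ) = (d : ℝ) ^ 2 by field_simp,
      Real.sqrt_sq hd0.le]
  have hle : Real.sqrt (d * δ) ≤ Real.sqrt (d / δ) := by
    apply Real.sqrt_le_sqrt
    rw [le_div_iff₀ hδ0, mul_assoc]
    exact mul_le_of_le_one_right hd0.le (by nlinarith)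
  have hm2 : ((1 + w) * Real.sqrt (d * δ)) ^ 2 = d * ((1 + w) ^ 2 * δ) := by
    rw [mul_pow, Real.sq_sqrt hX0.le]; ring
  have hN2 : Real.sqrt (d / δ) ^ 2 = d / δ := Real.sq_sqrt hN0.le
  have hm0 : 0 < (1 + w) * Real.sqrt (d * δ) := by positivity
  have hmle : (1 + w) * Real.sqrt (d * δ) ≤ 2 * Real.sqrt (d / δ) :=
    mul_le_mul (by linarith) hle (Real.sqrt_nonneg _) zero_le_two
  have hmN : (1 + w) * Real.sqrt (d * δ) * Real.sqrt (d / δ) = (1 + w) * d := by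
    rw [mul_assoc, hXN]
  have hs1 : 2 / 3 ≤ Real.sqrt (1 - δ) := Real.le_sqrt_of_sq_le (by linarith)
  have hs2 : Real.sqrt (1 - δ) ≤ 1 := Real.sqrt_le_one.2 (by linarith)
  have hs3 : Real.sqrt (1 - δ) ^ 2 = 1 - δ := Real.sq_sqrt (by linarith)
  have hdinv : 1 / (d : ℝ) ≤ 1 / 2 := one_div_le_one_div_of_le two_pos hd2
  have hdinv0 : 0 < 1 / (d : ℝ) := by positivity
  have hNd : (d : ℝ) / δ * (1 - δ - 2 * (1 / d)) = d / δ - d - 2 / δ := by field_simp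
  have hρ : (d : ℝ) / δ * (1 - δ - 2 * (1 / d)) ≤ d / δ * (Real.sqrt (1 - δ) - 1 / d) ^ 2 := by
    apply mul_le_mul_of_nonneg_left _ hN0.le
    have := mul_le_mul_of_nonneg_right hs2 hdinv0.le
    have := sq_nonneg (1 / (d : ℝ))
    linarith
  refine norm_smul_toLp_sub_le hN0 (by linarith) v x (le_trans ?_ hρ)
  rw [hNd]
  set M := Real.sqrt (d / δ)
  set m := (1 + w) * Real.sqrt (d * δ)
  have hexp : ∑ i, (x i - M * v i) ^ 2 =
      ∑ i, b i ^ 2 + 2 * (m - M) * ∑ i, v i * b i + (m - M) ^ 2 := by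
    rw [Finset.mul_sum, ← mul_one ((m - M) ^ 2), ← hv, Finset.mul_sum,
      ← Finset.sum_add_distrib, ← Finset.sum_add_distrib]
    refine Finset.sum_congr rfl fun i _ => ?_
    rw [hb]
    ring
  have hcross : 2 * (m - M) * ∑ i, v i * b i ≤ 12 * M := by
    refine (le_abs_self _).trans ?_
    rw [abs_mul, abs_mul, abs_two]
    have hM : 0 ≤ M := Real.sqrt_nonneg _
    have h1 : |m - M| ≤ 3 * M := abs_le.2 ⟨by linarith, by linarith⟩
    have := mul_le_mul h1 hb2 (abs_nonneg _) (by positivity)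
    linarith
  have e2 : (m - M) ^ 2 = d * ((1 + w) ^ 2 * δ) - 2 * ((1 + w) * d) + d / δ := by
    rw [← hm2, ← hmN, ← hN2]; ring
  -- Of the slack wd/8, one half covers the excess of ∑ bᵢ² over d, the other the cross term and
  -- 2/δ.
  have := mul_le_mul_of_nonneg_left hquad hd0.le
  rw [hexp, e2]
  linarith

/-- The chance that a random codeword approximates a given unit vector, for small `δ`. -/
theorem exists_le_stdPi_near_of_le {t K : ℝ} (ht : 0 < t) (hK : 0 < K) :
    ∃ d₀ : ℕ, ∀ d : ℕ, d₀ ≤ d → ∀ δ : ℝ, Admissible t K d δ → δ ≤ 4 / 9 →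
      ∀ v : Vec d, ‖v‖ = 1 →
        1 / 2 * Real.exp (t / 8 * (d * δ)) * Real.exp (-((2 + t) ^ 2 * (d * δ) / 8)) ≤
          (stdPi d).real {x | ‖(1 / Real.sqrt ((d : ℝ) / δ)) • (WithLp.toLp 2 x : Vec d) - v‖ ≤
            Real.sqrt (1 - δ) - 1 / d} := by
  obtain ⟨w, hw⟩ : ∃ w, w = 3 / 4 * min (t / 2) 1 := ⟨_, rfl⟩
  have hw0 : 0 < w := by rw [hw]; positivity
  have hw1 : w ≤ 1 := by have := min_le_right (t / 2) 1; linarith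
  have hwt : w ≤ 3 / 4 * (t / 2) := by have := min_le_left (t / 2) 1; linarith
  obtain ⟨d₁, hd₁⟩ := exists_half_le_stdPi_typical (η := w / 16) (by positivity)
  obtain ⟨d₂, hd₂⟩ := Admissible.exists_le_mul (t := t) hK (max 1 ((14 * 16 / w) ^ 2))
  refine ⟨max 2 (max d₁ d₂), fun d hd δ hadm hδ v hv => ?_⟩
  simp only [max_le_iff] at hd hd₂
  obtain ⟨hX1, hX2⟩ := hd₂ d hd.2.2 δ hadm
  obtain ⟨hδ0, hδ1, hδt, -⟩ := hadm
  have hd0 : (0 : ℝ) < d := by exact_mod_cast two_pos.trans_le hd.1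
  have hX0 : 0 < (d : ℝ) * δ := by positivity
  have hv2 : ∑ i, v i ^ 2 = 1 := by rw [← EuclideanSpace.real_norm_sq_eq, hv, one_pow]
  have hhalf := hd₁ d hd.2.1 v hv2
  set A := {x : Fin d → ℝ | ∑ i, x i ^ 2 ≤ (1 + w / 16) * d ∧ |∑ i, v i * x i| ≤ 2} with hA
  have hAm : MeasurableSet A := by
    rw [hA, Set.ofPred_and]
    exact (measurableSet_le (by fun_prop) (by fun_prop)).inter
      (measurableSet_le (by fun_prop) (by fun_prop))
  have hAs : ∀ x ∈ A, -x ∈ A := by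
    intro x hx
    simpa [hA] using hx
  have hshift := exp_mul_stdPi_le_stdPi_translate
    (fun i => (1 + w) * Real.sqrt (d * δ) * v i) hAm hAs
  have hm2 : ∑ i, ((1 + w) * Real.sqrt (d * δ) * v i) ^ 2 = (1 + w) ^ 2 * (d * δ) := by
    simp only [mul_pow, ← Finset.mul_sum, hv2, mul_one, Real.sq_sqrt hX0.le]
  rw [hm2] at hshift
  refine le_trans ?_ (hshift.trans (measureReal_mono fun x hx =>
    norm_sub_le_of_typical hd.1 hδ0 hδ hw0 hw1 (quadratic_slack ht hδ0 hδ hδt hw)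
      (sampling_error_le hd0 hδ0 hw0 hX1 hX2) hv2 (fun i => rfl) hx.1 hx.2))
  have hfin : Real.exp (t / 8 * (d * δ)) * Real.exp (-((2 + t) ^ 2 * (d * δ) / 8)) ≤
      Real.exp (-((1 + w) ^ 2 * (d * δ) / 2)) := by
    rw [← Real.exp_add, Real.exp_le_exp]
    have h1 : (1 + w) ^ 2 ≤ (1 + 3 / 4 * (t / 2)) ^ 2 :=
      pow_le_pow_left₀ (by linarith) (by linarith) 2
    have h2 : 0 ≤ (2 + t) ^ 2 / 8 - (1 + w) ^ 2 / 2 - t / 8 := by nlinarith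
    have := mul_nonneg h2 hX0.le
    linarith
  calc _ = 1 / 2 * (Real.exp (t / 8 * (d * δ)) * Real.exp (-((2 + t) ^ 2 * (d * δ) / 8))) := by
        ring
    _ ≤ 1 / 2 * Real.exp (-((1 + w) ^ 2 * (d * δ) / 2)) := by linarith
    _ ≤ _ := by
      rw [mul_comm]
      exact mul_le_mul_of_nonneg_left hhalf (Real.exp_pos _).le

/-! ### One vector, δ ≥ 4/9: a cube around √N v -/

/-- The right side bounds from below the exponent per dimension of the cube estimate, -1/(2δ) being
the cost of translation. With s = √δ the hypothesis gives (2+t)(1-s) ≥ 2, so (2+t)²δ/8 ≥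
s²/(2(1-s)²), a double pole at s = 1 against the simple pole of δ/(1-δ). -/
theorem rate_inequality {t δ : ℝ} (ht : 0 < t) (hδ : 4 / 9 ≤ δ) (h : (2 + t) ^ 2 * δ < t ^ 2) :
    1 / 20 - (2 + t) ^ 2 * δ / 8 ≤
      -(1 / (2 * δ)) + 1 / 2 - 871 / 1000 * (δ / (1 - δ)) - 361 / 800 * ((1 - δ) / δ) := by
  have hδ0 : 0 < δ := by linarith
  obtain ⟨s, hs0, rfl⟩ : ∃ s : ℝ, 0 < s ∧ δ = s ^ 2 :=
    ⟨Real.sqrt δ, Real.sqrt_pos.2 hδ0, (Real.sq_sqrt hδ0.le).symm⟩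
  have hs : 2 / 3 ≤ s := by nlinarith
  have h1 : (2 + t) * s < t := by
    refine lt_of_pow_lt_pow_left₀ 2 ht.le ?_
    rw [mul_pow]; exact h
  have hs1 : s < 1 := by nlinarith
  have h2 : 2 ≤ (2 + t) * (1 - s) := by nlinarith
  have h3 : s ^ 2 / (2 * (1 - s) ^ 2) ≤ (2 + t) ^ 2 * s ^ 2 / 8 := by
    rw [div_le_div_iff₀ (by nlinarith) (by norm_num)]
    have h4 : 2 ^ 2 ≤ ((2 + t) * (1 - s)) ^ 2 := pow_le_pow_left₀ (by norm_num) h2 2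
    nlinarith [sq_nonneg s]
  have hs' : 0 < 1 - s := by linarith
  have e1 : s ^ 2 / (2 * (1 - s) ^ 2) - 871 / 1000 * (s ^ 2 / (1 - s ^ 2)) =
      s ^ 2 / (1 - s) * (1 / (2 * (1 - s)) - 871 / 1000 * (1 / (1 + s))) := by
    rw [show 1 - s ^ 2 = (1 - s) * (1 + s) by ring]
    field_simp
  have b1 : 4 / 3 ≤ s ^ 2 / (1 - s) := by rw [le_div_iff₀ hs']; nlinarith
  have b2 : 3 / 2 ≤ 1 / (2 * (1 - s)) := by rw [le_div_iff₀ (by linarith)]; nlinarith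
  have b3 : 1 / (1 + s) ≤ 3 / 5 := by rw [div_le_iff₀ (by linarith)]; nlinarith
  have b4 : 1 / s ^ 2 ≤ 9 / 4 := by rw [div_le_iff₀ hδ0]; nlinarith
  have e2 : 1 / (2 * s ^ 2) = 1 / 2 * (1 / s ^ 2) := by field_simp
  have e3 : (1 - s ^ 2) / s ^ 2 = 1 / s ^ 2 - 1 := by field_simp
  have b5 : 4 / 3 * (9774 / 10000) ≤
      s ^ 2 / (1 - s) * (1 / (2 * (1 - s)) - 871 / 1000 * (1 / (1 + s))) :=
    mul_le_mul b1 (by linarith) (by norm_num) (by linarith)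
  rw [e2, e3]
  linarith

/-- The chance that a random codeword approximates a given unit vector, for large `δ`. -/
theorem exists_le_stdPi_near_of_ge {t : ℝ} (ht : 0 < t) (K : ℝ) :
    ∃ d₀ : ℕ, ∀ d : ℕ, d₀ ≤ d → ∀ δ : ℝ, Admissible t K d δ → 4 / 9 ≤ δ →
      ∀ v : Vec d, ‖v‖ = 1 →
        Real.exp (1 / 20 * (d * δ)) * Real.exp (-((2 + t) ^ 2 * (d * δ) / 8)) ≤
          (stdPi d).real {x | ‖(1 / Real.sqrt ((d : ℝ) / δ)) • (WithLp.toLp 2 x : Vec d) - v‖ ≤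
            Real.sqrt (1 - δ) - 1 / d} := by
  have hκ : 0 < 1 - t ^ 2 / (2 + t) ^ 2 := by
    rw [sub_pos, div_lt_one (by positivity)]; nlinarith
  -- Admissibility keeps δ below t²/(2+t)² < 1, so 1/d is eventually at most √(1-δ)/20. The factor
  -- 19/20 in r makes room for it.
  obtain ⟨d₀, hd₀⟩ := exists_nat_ge (20 / Real.sqrt (1 - t ^ 2 / (2 + t) ^ 2))
  refine ⟨d₀ + 1, fun d hd δ hadm hδ v hv => ?_⟩
  obtain ⟨hδ0, hδ1, hδt, -⟩ := hadm
  have hd0 : (0 : ℝ) < d := by exact_mod_cast (Nat.succ_pos d₀).trans_le hd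
  have hd1 : 20 / Real.sqrt (1 - t ^ 2 / (2 + t) ^ 2) ≤ d :=
    hd₀.trans (by exact_mod_cast (Nat.le_succ d₀).trans hd)
  have hδ' : 0 < 1 - δ := by linarith
  have hdinv : 1 / (d : ℝ) ≤ 1 / 20 * Real.sqrt (1 - δ) := by
    have h1 : Real.sqrt (1 - t ^ 2 / (2 + t) ^ 2) ≤ Real.sqrt (1 - δ) := by
      apply Real.sqrt_le_sqrt
      rw [sub_le_sub_iff_left, le_div_iff₀ (by positivity)]
      linarith
    rw [div_le_iff₀ (Real.sqrt_pos.2 hκ)] at hd1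
    rw [div_le_iff₀ hd0]
    nlinarith
  set N := (d : ℝ) / δ with hN
  have hN0 : 0 < N := by positivity
  set r := 19 / 20 * Real.sqrt ((1 - δ) / δ) with hr
  have hr0 : 0 < r := by positivity
  have hr2 : r ^ 2 = 361 / 400 * ((1 - δ) / δ) := by
    rw [hr, mul_pow, Real.sq_sqrt (by positivity)]; norm_num
  have hv2 : ∑ i, v i ^ 2 = 1 := by rw [← EuclideanSpace.real_norm_sq_eq, hv, one_pow]
  set A := {x : Fin d → ℝ | ∀ i, |x i| ≤ r} with hA
  have hAm : MeasurableSet A := by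
    rw [hA, Set.ofPred_forall]
    exact MeasurableSet.iInter fun i => measurableSet_le (by fun_prop) (by fun_prop)
  have hAs : ∀ x ∈ A, -x ∈ A := by
    intro x hx
    simpa [hA] using hx
  have hshift := exp_mul_stdPi_le_stdPi_translate (fun i => Real.sqrt N * v i) hAm hAs
  simp only [mul_pow, ← Finset.mul_sum, hv2, mul_one, Real.sq_sqrt hN0.le] at hshift
  have hsub : {x : Fin d → ℝ | (x - fun i => Real.sqrt N * v i) ∈ A} ⊆
      {x | ‖(1 / Real.sqrt N) • (WithLp.toLp 2 x : Vec d) - v‖ ≤ Real.sqrt (1 - δ) - 1 / d} := by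
    intro x hx
    refine norm_smul_toLp_sub_le hN0 (by linarith [Real.sqrt_nonneg (1 - δ)]) v x ?_
    have h1 : ∑ i, (x i - Real.sqrt N * v i) ^ 2 ≤ ∑ _i : Fin d, r ^ 2 :=
      Finset.sum_le_sum fun i _ => sq_le_sq.2 ((hx i).trans (le_abs_self r))
    refine h1.trans ?_
    rw [Finset.sum_const, Finset.card_univ, Fintype.card_fin, nsmul_eq_mul]
    calc (d : ℝ) * r ^ 2 = N * (19 / 20 * Real.sqrt (1 - δ)) ^ 2 := by
          rw [hr2, mul_pow, Real.sq_sqrt hδ'.le, hN]; field_simp; norm_num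
      _ ≤ _ := by
          apply mul_le_mul_of_nonneg_left _ hN0.le
          exact pow_le_pow_left₀ (by positivity) (by linarith) 2
  refine le_trans ?_ (hshift.trans (measureReal_mono hsub))
  refine le_trans ?_ (mul_le_mul_of_nonneg_left (pow_le_stdPi_cube hr0.le) (Real.exp_pos _).le)
  set y := Real.sqrt (2 / Real.pi) * r with hy
  have hy0 : 0 < y := by have := Real.pi_pos; positivity
  have hy2 : 1 / y ^ 2 ≤ 871 / 500 * (δ / (1 - δ)) := by
    rw [hy, mul_pow, Real.sq_sqrt (by have := Real.pi_pos; positivity), hr2]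
    have := Real.pi_lt_d4
    have e : 1 / (2 / Real.pi * (361 / 400 * ((1 - δ) / δ))) =
        200 / 361 * Real.pi * (δ / (1 - δ)) := by
      have := Real.pi_pos
      field_simp
      norm_num
    rw [e]
    apply mul_le_mul_of_nonneg_right _ (by positivity)
    linarith
  have hyexp : Real.exp (1 / 2 - 871 / 1000 * (δ / (1 - δ))) ≤ y := by
    refine le_of_sq_le_sq ?_ hy0.le
    rw [← Real.exp_nat_mul]
    -- This is log y² ≥ 1 - 1/y².
    have h1 : Real.exp (1 - 1 / y ^ 2) ≤ y ^ 2 := by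
      have := Real.add_one_le_exp (1 / y ^ 2 - 1)
      rw [sub_add_cancel, div_le_iff₀ (by positivity)] at this
      rw [← neg_sub, Real.exp_neg]
      exact inv_le_of_inv_le₀ (by positivity) (by
        rw [inv_le_iff_one_le_mul₀ (by positivity)]; linarith)
    refine le_trans (Real.exp_le_exp.2 ?_) h1
    push_cast
    linarith
  have hstep : Real.exp (1 / 20 - (2 + t) ^ 2 * δ / 8) * Real.exp (1 / (2 * δ)) ≤
      y * Real.exp (-(r ^ 2 / 2)) := by
    refine le_trans ?_ (mul_le_mul_of_nonneg_right hyexp (Real.exp_pos _).le)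
    rw [← Real.exp_add, ← Real.exp_add, Real.exp_le_exp, hr2]
    linarith [rate_inequality ht hδ hδt]
  -- As N = d/δ, the d-th power of e^{1/(2δ)} cancels e^{-N/2}.
  calc _ ≤ Real.exp (-(N / 2)) *
        (Real.exp (1 / 20 - (2 + t) ^ 2 * δ / 8) * Real.exp (1 / (2 * δ))) ^ d := by
        rw [← Real.exp_add, ← Real.exp_add, ← Real.exp_nat_mul, ← Real.exp_add, Real.exp_le_exp]
        have e : -(N / 2) + d * (1 / 20 - (2 + t) ^ 2 * δ / 8 + 1 / (2 * δ)) =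
            1 / 20 * d - (2 + t) ^ 2 * (d * δ) / 8 := by
          rw [hN]; field_simp; ring
        rw [e]
        nlinarith
    _ ≤ _ := by gcongr

/-- A random codeword approximates a given unit vector with a margin `1 / d`, with probability
exceeding `e^{-(2+t)² dδ/8}` by more than a factor of order `log d`. -/
theorem exists_le_stdPi_near {t K : ℝ} (ht : 0 < t) (hK : 0 < K) :
    ∃ d₀ : ℕ, ∀ d : ℕ, d₀ ≤ d → ∀ δ : ℝ, Admissible t K d δ → ∀ v : Vec d, ‖v‖ = 1 →
      Real.exp (-((2 + t) ^ 2 * (d * δ) / 8)) * (1 + Real.log (2 * (d : ℝ) ^ 2 + 1)) ≤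
        (stdPi d).real {x | ‖(1 / Real.sqrt ((d : ℝ) / δ)) • (WithLp.toLp 2 x : Vec d) - v‖ ≤
          Real.sqrt (1 - δ) - 1 / d} := by
  obtain ⟨d₁, hd₁⟩ := exists_le_stdPi_near_of_le ht hK
  obtain ⟨d₂, hd₂⟩ := exists_le_stdPi_near_of_ge ht K
  obtain ⟨X₁, hX₁⟩ := exists_linear_le_exp (a := t / 8) (by positivity) (2 * 3) (2 * (2 * K))
  obtain ⟨X₂, hX₂⟩ := exists_linear_le_exp (a := 1 / 20) (by norm_num) 3 (2 * K)
  obtain ⟨d₃, hd₃⟩ := Admissible.exists_le_mul (t := t) hK (max X₁ X₂)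
  refine ⟨max 1 (max d₁ (max d₂ d₃)), fun d hd δ hadm v hv => ?_⟩
  simp only [max_le_iff] at hd hd₃
  obtain ⟨h1, h2⟩ := hd₃ d hd.2.2.2 δ hadm
  have hlog : 1 + Real.log (2 * (d : ℝ) ^ 2 + 1) ≤ 3 + 2 * K * (d * δ) := by
    have := log_two_mul_sq_add_one_le hd.1
    linarith [hadm.2.2.2]
  rw [mul_comm]
  rcases le_total δ (4 / 9) with h | h
  · refine le_trans ?_ (hd₁ d hd.2.1 δ hadm h v hv)
    apply mul_le_mul_of_nonneg_right _ (Real.exp_pos _).le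
    linarith [hX₁ _ h1]
  · refine le_trans ?_ (hd₂ d hd.2.2.1 δ hadm h v hv)
    apply mul_le_mul_of_nonneg_right _ (Real.exp_pos _).le
    linarith [hX₂ _ h2]

/-! ### Net and union bound -/

/-- A `1 / d`-net of the unit sphere, obtained by rounding the coordinates. -/
theorem exists_net (d : ℕ) : ∃ T : Finset (Vec d), (∀ u ∈ T, ‖u‖ = 1) ∧
    T.card ≤ (2 * d ^ 2 + 1) ^ d ∧ ∀ v : Vec d, ‖v‖ = 1 → ∃ u ∈ T, ‖v - u‖ ≤ 1 / d := by
  classical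
  let φ : Vec d → Fin d → ℤ := fun v i => ⌊(d : ℝ) ^ 2 * v i⌋
  let P : (Fin d → ℤ) → Prop := fun z => ∃ v : Vec d, ‖v‖ = 1 ∧ φ v = z
  let g : (Fin d → ℤ) → Vec d := fun z => if h : P z then h.choose else 0
  have hg : ∀ z, P z → ‖g z‖ = 1 ∧ φ (g z) = z := fun z hz => by
    simp only [g, dif_pos hz]; exact hz.choose_spec
  let F := Fintype.piFinset fun _ : Fin d => Finset.Icc (-((d : ℤ) ^ 2)) ((d : ℤ) ^ 2)
  refine ⟨(F.filter P).image g, ?_, ?_, fun v hv => ?_⟩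
  · intro u hu
    obtain ⟨z, hz, rfl⟩ := Finset.mem_image.1 hu
    exact (hg z (Finset.mem_filter.1 hz).2).1
  · refine Finset.card_image_le.trans ((Finset.card_filter_le _ _).trans ?_)
    simp only [F, Fintype.card_piFinset, Int.card_Icc, Finset.prod_const, Finset.card_univ,
      Fintype.card_fin]
    apply Nat.pow_le_pow_left
    rw [Int.toNat_le]
    push_cast
    linarith
  · have hP : P (φ v) := ⟨v, hv, rfl⟩
    refine ⟨g (φ v), Finset.mem_image_of_mem g (Finset.mem_filter.2 ⟨?_, hP⟩), ?_⟩
    · rw [Fintype.mem_piFinset]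
      intro i
      have h1 : |v i| ≤ 1 := by
        have := PiLp.norm_apply_le v i
        rwa [hv] at this
      have h2 := abs_le.1 h1
      have h3 : (0 : ℝ) ≤ (d : ℝ) ^ 2 := by positivity
      rw [Finset.mem_Icc]
      constructor
      · rw [Int.le_floor]; push_cast; nlinarith
      · rw [← Int.cast_le (R := ℝ)]
        refine (Int.floor_le _).trans ?_
        push_cast; nlinarith
    · obtain ⟨-, h2⟩ := hg _ hP
      rcases Nat.eq_zero_or_pos d with rfl | hd
      · simp [Subsingleton.elim (v - g (φ v)) 0]
      have hd0 : (0 : ℝ) < d := by exact_mod_cast hd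
      have hd1 : (1 : ℝ) ≤ d := by exact_mod_cast hd
      refine le_of_sq_le_sq ?_ (by positivity)
      rw [EuclideanSpace.real_norm_sq_eq]
      -- Equal floors put the coordinates within 1/d², so the squared distance is at most d · d⁻⁴ ≤
      -- d⁻².
      have h3 : ∀ i, (v - g (φ v)) i ^ 2 ≤ (1 / (d : ℝ) ^ 2) ^ 2 := fun i => by
        have h4 := Int.abs_sub_lt_one_of_floor_eq_floor (congrFun h2 i)
        rw [← mul_sub, abs_mul, abs_of_pos (by positivity : (0 : ℝ) < (d : ℝ) ^ 2), abs_sub_comm,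
          mul_comm] at h4
        rw [PiLp.sub_apply, sq_le_sq, abs_of_pos (by positivity : 0 < 1 / (d : ℝ) ^ 2)]
        exact (lt_div_iff₀ (by positivity)).2 h4 |>.le
      refine (Finset.sum_le_sum fun i _ => h3 i).trans ?_
      rw [Finset.sum_const, Finset.card_univ, Fintype.card_fin, nsmul_eq_mul,
        show (d : ℝ) * (1 / (d : ℝ) ^ 2) ^ 2 = 1 / d ^ 3 by field_simp, div_pow, one_pow]
      exact one_div_le_one_div_of_le (by positivity) (pow_le_pow_right₀ hd1 (by norm_num))

theorem isCompressor_quantize {d n : ℕ} [NeZero n] {δ ε : ℝ} (hδ : δ ≤ 1) {c : Fin n → Vec d}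
    {T : Set (Vec d)} (hT : ∀ v : Vec d, ‖v‖ = 1 → ∃ u ∈ T, ‖v - u‖ ≤ ε)
    (hc : ∀ u ∈ T, ∃ j, ‖c j - u‖ ≤ Real.sqrt (1 - δ) - ε) : IsCompressor δ (quantize c) := by
  intro v hv
  obtain ⟨u, hu, hvu⟩ := hT v hv
  obtain ⟨j, hj⟩ := hc u hu
  have h1 := (exists_nearest c v).choose_spec j
  rw [norm_sub_rev]
  refine le_trans h1 ?_
  have h2 : ‖v - c j‖ ≤ Real.sqrt (1 - δ) := by
    have := norm_sub_le_norm_sub_add_norm_sub v u (c j)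
    rw [norm_sub_rev u] at this
    linarith
  calc ‖v - c j‖ ^ 2 ≤ Real.sqrt (1 - δ) ^ 2 := pow_le_pow_left₀ (norm_nonneg _) h2 2
    _ = 1 - δ := Real.sq_sqrt (by linarith)

/-- The union bound over a net. -/
theorem one_sub_le_gaussianLaw_isCompressor {d n : ℕ} [NeZero n] {δ ε N q : ℝ} (hδ : δ ≤ 1)
    {T : Finset (Vec d)} (hT : ∀ v : Vec d, ‖v‖ = 1 → ∃ u ∈ T, ‖v - u‖ ≤ ε)
    (hq : ∀ u ∈ T, q ≤ (stdPi d).real {x | ‖(1 / Real.sqrt N) • (WithLp.toLp 2 x : Vec d) - u‖ ≤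
      Real.sqrt (1 - δ) - ε}) :
    1 - T.card * Real.exp (-(n * q)) ≤
      (gaussianLaw d n).real {a | IsCompressor δ (quantize (codebook N a))} := by
  have : IsProbabilityMeasure (gaussianLaw d n) := by unfold gaussianLaw; infer_instance
  let G : Vec d → Set (Fin d → ℝ) := fun u =>
    {x | ‖(1 / Real.sqrt N) • (WithLp.toLp 2 x : Vec d) - u‖ ≤ Real.sqrt (1 - δ) - ε}
  have hG : ∀ u, MeasurableSet (G u) := fun u => measurableSet_le (by fun_prop) (by fun_prop)
  let B : Vec d → Set (Fin n → Fin d → ℝ) := fun u => Set.univ.pi fun _ => (G u)ᶜ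
  have hB : ∀ u ∈ T, (gaussianLaw d n).real (B u) ≤ Real.exp (-(n * q)) := fun u hu => by
    have h1 : (gaussianLaw d n).real (B u) = (1 - (stdPi d).real (G u)) ^ n := by
      rw [← probReal_compl_eq_one_sub (hG u), measureReal_def, gaussianLaw, Measure.pi_pi,
        ENNReal.toReal_prod]
      simp only [Finset.prod_const, Finset.card_univ, Fintype.card_fin]
      rfl
    have h2 : 1 - (stdPi d).real (G u) ≤ Real.exp (-q) := by
      have h3 := hq u hu
      have := Real.add_one_le_exp (-q)
      linarith
    rw [h1, ← mul_neg, Real.exp_nat_mul]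
    exact pow_le_pow_left₀ (sub_nonneg.2 measureReal_le_one) h2 n
  have hcover : (Set.univ : Set (Fin n → Fin d → ℝ)) ⊆
      {a | IsCompressor δ (quantize (codebook N a))} ∪ ⋃ u ∈ T, B u := by
    intro a _
    by_cases ha : a ∈ ⋃ u ∈ T, B u
    · exact Or.inr ha
    · refine Or.inl (isCompressor_quantize hδ (T := (T : Set (Vec d))) hT fun u hu => ?_)
      by_contra hcon
      refine ha (Set.mem_biUnion hu fun j _ hj => hcon ⟨j, hj⟩)
  have h1 := (measureReal_mono hcover (μ := gaussianLaw d n)).trans (measureReal_union_le _ _)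
  have h2 := (measureReal_biUnion_finset_le (μ := gaussianLaw d n) T B).trans
    (Finset.sum_le_sum hB)
  rw [Finset.sum_const, nsmul_eq_mul] at h2
  rw [probReal_univ] at h1
  linarith

theorem probBound_le_gaussianLaw_isCompressor {t K : ℝ} (ht : 0 < t) (hK : 0 < K) :
    ∃ d₀ : ℕ, ∀ d : ℕ, d₀ ≤ d → ∀ δ : ℝ, Admissible t K d δ → ∀ (n : ℕ) [NeZero n],
      probBound d n δ t ≤ (gaussianLaw d n).real
        {a | IsCompressor δ (quantize (codebook ((d : ℝ) / δ) a))} := by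
  obtain ⟨d₁, hd₁⟩ := exists_le_stdPi_near ht hK
  obtain ⟨d₂, hd₂⟩ := Admissible.exists_le_mul (t := t) hK 1
  refine ⟨max d₁ d₂, fun d hd δ hadm n _ => ?_⟩
  rw [max_le_iff] at hd
  have hX := hd₂ d hd.2 δ hadm
  obtain ⟨T, hT1, hT2, hT3⟩ := exists_net d
  have hunion := one_sub_le_gaussianLaw_isCompressor (n := n) hadm.2.1.le hT3
    fun u hu => hd₁ d hd.1 δ hadm u (hT1 u hu)
  have hδ1 : 0 < 1 - δ := by linarith [hadm.2.1]
  have hs0 : 0 < Real.sqrt (1 - δ) := Real.sqrt_pos.2 hδ1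
  have hs1 : Real.sqrt (1 - δ) ≤ 1 := Real.sqrt_le_one.2 (by linarith [hadm.1])
  have hd0 : (0 : ℝ) ≤ d := Nat.cast_nonneg d
  set p := Real.exp (-((2 + t) ^ 2 * (d * δ) / 8)) with hp
  have hp0 : 0 < p := Real.exp_pos _
  set D := 2 * Real.sqrt (2 * Real.pi) * (2 + t) * Real.sqrt (d * δ) with hD
  have hD1 : 1 ≤ D := by
    have h1 : 1 ≤ Real.sqrt (2 * Real.pi) := Real.one_le_sqrt.2 (by linarith [Real.pi_gt_three])
    have h2 : 1 ≤ Real.sqrt (d * δ) := Real.one_le_sqrt.2 hX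
    exact one_le_mul_of_one_le_of_one_le
      (one_le_mul_of_one_le_of_one_le (by linarith) (by linarith)) h2
  set L := Real.log (2 * (d : ℝ) ^ 2 + 1) with hL
  have hL0 : 0 ≤ L := Real.log_nonneg (by nlinarith)
  have hcard : (T.card : ℝ) ≤ Real.exp (d * L) := by
    rw [Real.exp_nat_mul, hL, Real.exp_log (by positivity)]
    exact_mod_cast hT2
  unfold probBound
  rw [← hp, ← hD]
  have hR : 2 * (d : ℝ) ≤ 2 * d / Real.sqrt (1 - δ) := by
    rw [le_div_iff₀ hs0]
    exact mul_le_of_le_one_right (by positivity) hs1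
  set R := 2 * (d : ℝ) / Real.sqrt (1 - δ)
  set α := (n : ℝ) / D * p with hα
  -- If α ≤ R the claimed bound is at most 0. Otherwise α ≥ R ≥ 2d, and the surplus αL from the
  -- logarithmic factor exceeds the entropy dL of the net.
  rcases le_total α R with h | h
  · have := Real.one_le_exp (show 0 ≤ -α + R by linarith)
    have := measureReal_nonneg (μ := gaussianLaw d n)
      (s := {a | IsCompressor δ (quantize (codebook ((d : ℝ) / δ) a))})
    linarith
  · refine le_trans (sub_le_sub_left ?_ 1) hunion
    refine (mul_le_mul_of_nonneg_right hcard (Real.exp_pos _).le).trans ?_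
    rw [← Real.exp_add, Real.exp_le_exp]
    have h1 : α ≤ n * p := by
      rw [hα]
      exact mul_le_mul_of_nonneg_right (div_le_self (Nat.cast_nonneg n) hD1) hp0.le
    have h2 : α * (1 + L) ≤ n * p * (1 + L) := mul_le_mul_of_nonneg_right h1 (by linarith)
    have h3 : 2 * d * L ≤ α * L := mul_le_mul_of_nonneg_right (hR.trans h) hL0
    have h4 : 0 ≤ d * L := mul_nonneg hd0 hL0
    linarith

/-! ### Number of codewords and bits -/

/-- With X = dδ, each term of the constant pays for one loss: (2+t)²/8 cancels the Gaussian
exponential, K gives e^{KX} ≥ d, which controls 2d/√(1-δ), and 1 gives e^X, which beats √X and the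
constants. -/
theorem exists_one_sub_le_probBound {t K : ℝ} (ht : 0 < t) (hK : 0 < K) {η : ℝ} (hη : 0 < η) :
    ∃ d₀ : ℕ, ∀ d : ℕ, d₀ ≤ d → ∀ δ : ℝ, Admissible t K d δ → ∀ n : ℕ,
      Real.exp (((2 + t) ^ 2 / 8 + 1 + K) * (d * δ)) ≤ n → 1 - η ≤ probBound d n δ t := by
  have hκ : 0 < 1 - t ^ 2 / (2 + t) ^ 2 := by
    rw [sub_pos, div_lt_one (by positivity)]; nlinarith
  set κ := Real.sqrt (1 - t ^ 2 / (2 + t) ^ 2)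
  have hκ0 : 0 < κ := Real.sqrt_pos.2 hκ
  set B := 2 * Real.sqrt (2 * Real.pi) * (2 + t) with hB
  have hB0 : 0 < B := by have := Real.pi_pos; positivity
  obtain ⟨X₀, hX₀⟩ := exists_linear_le_exp one_pos 0 (B * (2 / κ + |Real.log η|))
  obtain ⟨d₁, hd₁⟩ := Admissible.exists_le_mul (t := t) hK (max 1 X₀)
  refine ⟨d₁ + 1, fun d hd δ hadm n hn => ?_⟩
  have hd0 : (0 : ℝ) < d := by exact_mod_cast (Nat.succ_pos d₁).trans_le hd
  obtain ⟨hX1, hX2⟩ := max_le_iff.1 (hd₁ d ((Nat.le_succ d₁).trans hd) δ hadm)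
  obtain ⟨hδ0, hδ1, hδt, hlog⟩ := hadm
  unfold probBound
  rw [← hB]
  set X := (d : ℝ) * δ
  have hX0 : 0 < X := by linarith
  have hE : 1 ≤ Real.exp (K * X) := Real.one_le_exp (by positivity)
  have hdE : (d : ℝ) ≤ Real.exp (K * X) := (Real.log_le_iff_le_exp hd0).1 hlog
  have hR : 2 * (d : ℝ) / Real.sqrt (1 - δ) ≤ 2 / κ * Real.exp (K * X) := by
    have h1 : κ ≤ Real.sqrt (1 - δ) := by
      apply Real.sqrt_le_sqrt
      rw [sub_le_sub_iff_left, le_div_iff₀ (by positivity)]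
      linarith
    calc 2 * (d : ℝ) / Real.sqrt (1 - δ) ≤ 2 * d / κ :=
          div_le_div_of_nonneg_left (by positivity) hκ0 h1
      _ = 2 / κ * d := by ring
      _ ≤ _ := mul_le_mul_of_nonneg_left hdE (by positivity)
  have hα : (2 / κ + |Real.log η|) * Real.exp (K * X) ≤
      n / (B * Real.sqrt X) * Real.exp (-((2 + t) ^ 2 * X / 8)) := by
    rw [div_mul_eq_mul_div, le_div_iff₀ (by positivity)]
    have h1 : Real.sqrt X ≤ X := Real.sqrt_le_iff.2 ⟨hX0.le, by nlinarith⟩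
    have h2 := hX₀ X hX2
    rw [one_mul, zero_add] at h2
    calc (2 / κ + |Real.log η|) * Real.exp (K * X) * (B * Real.sqrt X) ≤
          (2 / κ + |Real.log η|) * Real.exp (K * X) * (B * X) := by gcongr
      _ = B * (2 / κ + |Real.log η|) * X * Real.exp (K * X) := by ring
      _ ≤ Real.exp X * Real.exp (K * X) := by gcongr
      _ = Real.exp (((2 + t) ^ 2 / 8 + 1 + K) * X) * Real.exp (-((2 + t) ^ 2 * X / 8)) := by
          rw [← Real.exp_add, ← Real.exp_add]; ring_nf
      _ ≤ _ := by gcongr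
  have hl : |Real.log η| ≤ |Real.log η| * Real.exp (K * X) :=
    le_mul_of_one_le_right (abs_nonneg _) hE
  rw [sub_le_sub_iff_left, ← Real.le_log_iff_exp_le hη]
  linarith [neg_abs_le (Real.log η)]

theorem clog_ceil_exp_le {x : ℝ} (hx : 4 ≤ x) : (Nat.clog 2 ⌈Real.exp x⌉₊ : ℝ) ≤ 2 * x := by
  have h2x : 0 ≤ 2 * x := by linarith
  refine le_trans ?_ (Nat.floor_le h2x)
  rw [Nat.cast_le, Nat.clog_le_iff_le_pow one_lt_two, Nat.ceil_le, Nat.cast_pow, Nat.cast_ofNat,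
    ← Real.rpow_natCast, Real.rpow_def_of_pos two_pos, Real.exp_le_exp]
  have h1 := Nat.lt_floor_add_one (2 * x)
  have h2 := Real.log_two_gt_d9
  nlinarith

/-! ### Lower bound by volume -/

/-- The points of the unit ball over a spherical cap of angular radius `arccos √δ` lie in a ball
of radius `ρ`. -/
theorem exists_center_of_cap {d : ℕ} {δ ρ β : ℝ} (hδ0 : 0 < δ)
    (hβ : 0 ≤ β) (hρ0 : 0 ≤ ρ)
    (hρ : ∀ r : ℝ, 0 ≤ r → r ≤ 1 → r ^ 2 - 2 * r * (β * Real.sqrt δ) + β ^ 2 ≤ ρ ^ 2)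
    (s : Vec d) : ∃ c : Vec d, ∀ v : Vec d, ‖v‖ = 1 → ‖s - v‖ ^ 2 ≤ 1 - δ →
      ∀ r : ℝ, 0 ≤ r → r ≤ 1 → ‖r • v - c‖ ≤ ρ := by
  refine ⟨(β / ‖s‖) • s, fun v hv hsv r hr0 hr1 => le_of_sq_le_sq ?_ hρ0⟩
  rcases eq_or_ne s 0 with rfl | hs
  · rw [zero_sub, norm_neg, hv] at hsv
    linarith
  have hs0 : 0 < ‖s‖ := norm_pos_iff.2 hs
  -- The cap condition says 2⟨v, s⟩ ≥ ‖s‖² + δ, which is at least 2‖s‖√δ.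
  have hinner : Real.sqrt δ ≤ inner ℝ v s / ‖s‖ := by
    rw [norm_sub_sq_real, hv, real_inner_comm] at hsv
    rw [le_div_iff₀ hs0]
    have := sq_nonneg (‖s‖ - Real.sqrt δ)
    have := Real.sq_sqrt hδ0.le
    linarith
  have hnorm : ‖(β / ‖s‖) • s‖ = β := by
    rw [norm_smul, norm_div, norm_norm, Real.norm_of_nonneg hβ, div_mul_cancel₀ _ hs0.ne']
  rw [norm_sub_sq_real, hnorm, norm_smul, hv, mul_one, Real.norm_of_nonneg hr0,
    real_inner_smul_left, real_inner_smul_right]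
  have h1 : r * (β * Real.sqrt δ) ≤ r * (β * (inner ℝ v s / ‖s‖)) := by gcongr
  have h2 : r * (β / ‖s‖ * inner ℝ v s) = r * (β * (inner ℝ v s / ‖s‖)) := by ring
  rw [h2]
  linarith [hρ r hr0 hr1]

/-- Comparison of volumes for a covering of the unit sphere. -/
theorem one_le_card_mul_pow {d : ℕ} [NeZero d] {δ ρ β : ℝ} (hδ0 : 0 < δ) (hβ : 0 ≤ β)
    (hρ0 : 0 ≤ ρ)
    (hρ : ∀ r : ℝ, 0 ≤ r → r ≤ 1 → r ^ 2 - 2 * r * (β * Real.sqrt δ) + β ^ 2 ≤ ρ ^ 2)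
    {S : Finset (Vec d)} (hS : ∀ v : Vec d, ‖v‖ = 1 → ∃ s ∈ S, ‖s - v‖ ^ 2 ≤ 1 - δ) :
    1 ≤ S.card * ρ ^ d := by
  choose c hc using exists_center_of_cap (d := d) hδ0 hβ hρ0 hρ
  have hcover : Metric.closedBall (0 : Vec d) 1 ⊆ ⋃ s ∈ S, Metric.closedBall (c s) ρ := by
    intro x hx
    rw [mem_closedBall_zero_iff] at hx
    obtain ⟨v, hv, hxv⟩ : ∃ v : Vec d, ‖v‖ = 1 ∧ x = ‖x‖ • v := by
      rcases eq_or_ne x 0 with rfl | h0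
      · exact ⟨EuclideanSpace.single 0 1, by simp, by simp⟩
      · have h1 : ‖x‖ ≠ 0 := norm_ne_zero_iff.2 h0
        exact ⟨‖x‖⁻¹ • x, by rw [norm_smul, norm_inv, norm_norm, inv_mul_cancel₀ h1], by
          rw [smul_smul, mul_inv_cancel₀ h1, one_smul]⟩
    obtain ⟨s, hs, hsv⟩ := hS v hv
    refine Set.mem_biUnion hs ?_
    rw [Metric.mem_closedBall, dist_eq_norm, hxv]
    exact hc s v hv hsv _ (norm_nonneg x) hx
  have hfin : volume (⋃ s ∈ S, Metric.closedBall (c s) ρ) ≠ ⊤ :=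
    ((measure_biUnion_finset_le S _).trans_lt (ENNReal.sum_lt_top.2 fun s _ =>
      measure_closedBall_lt_top)).ne
  have h1 := (measureReal_mono hcover (μ := volume) hfin).trans
    (measureReal_biUnion_finset_le S _)
  have hpos : 0 < (volume : Measure (Vec d)).real (Metric.closedBall 0 1) :=
    ENNReal.toReal_pos (Metric.measure_closedBall_pos _ _ one_pos).ne'
      measure_closedBall_lt_top.ne
  simp only [Measure.addHaar_real_closedBall' _ _ hρ0, Finset.sum_const, nsmul_eq_mul,
    finrank_euclideanSpace, Fintype.card_fin] at h1
  rw [← mul_assoc] at h1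
  exact le_of_mul_le_mul_right (by rwa [one_mul]) hpos

theorem div_two_le_logb_of_pow {d : ℕ} {k δ ρ : ℝ} (hρ0 : 0 < ρ)
    (hρ : Real.log (ρ ^ 2) ≤ -(δ * Real.log 2)) (h : 1 ≤ k * ρ ^ d) :
    d * δ / 2 ≤ Real.logb 2 k := by
  have hk : 0 < k := pos_of_mul_pos_left (one_pos.trans_le h) (by positivity)
  have h1 := Real.log_nonneg h
  rw [Real.log_mul hk.ne' (by positivity), Real.log_pow] at h1
  rw [Real.log_pow, Nat.cast_ofNat] at hρ
  rw [Real.logb, le_div_iff₀ (Real.log_pos one_lt_two)]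
  have := mul_le_mul_of_nonneg_left hρ (Nat.cast_nonneg (α := ℝ) d)
  linarith

theorem div_two_le_logb_card_of_cover {d : ℕ} {δ : ℝ} (hδ0 : 0 ≤ δ) (hδ1 : δ ≤ 1)
    {S : Finset (Vec d)} (hS : ∀ v : Vec d, ‖v‖ = 1 → ∃ s ∈ S, ‖s - v‖ ^ 2 ≤ 1 - δ) :
    d * δ / 2 ≤ Real.logb 2 S.card := by
  have hnonneg : 0 ≤ Real.logb 2 S.card :=
    div_nonneg (Real.log_natCast_nonneg _) (Real.log_nonneg one_le_two)
  rcases Nat.eq_zero_or_pos d with rfl | hd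
  · simpa using hnonneg
  have : NeZero d := ⟨hd.ne'⟩
  rcases hδ0.eq_or_lt with rfl | hδ0
  · simpa using hnonneg
  have hs := Real.sq_sqrt hδ0.le
  have hs0 := Real.sqrt_pos.2 hδ0
  have hl2 := Real.log_two_lt_d9
  have hl0 := Real.log_pos one_lt_two
  -- The ball must contain the apex r = 0 and the cap r = 1; convexity in r does the rest. For δ ≤
  -- 1/2, β = √δ and ρ² = 1-δ work; for δ ≥ 1/2, β = ρ = 1/(2√δ), the ball with the apex and the rim
  -- of the cap on its boundary.
  rcases le_total δ (1 / 2) with h | h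
  · have hρ2 : Real.sqrt (1 - δ) ^ 2 = 1 - δ := Real.sq_sqrt (by linarith)
    refine div_two_le_logb_of_pow (Real.sqrt_pos.2 (by linarith)) ?_
      (one_le_card_mul_pow hδ0 hs0.le (Real.sqrt_nonneg (1 - δ)) ?_ hS)
    · rw [hρ2]
      have := Real.log_le_sub_one_of_pos (show 0 < 1 - δ by linarith)
      nlinarith
    · intro r hr0 hr1
      rw [hρ2, ← pow_two, hs]
      nlinarith
  · have hρ2 : (1 / (2 * Real.sqrt δ)) ^ 2 = 1 / (4 * δ) := by
      rw [div_pow, mul_pow, hs]; norm_num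
    refine div_two_le_logb_of_pow (ρ := 1 / (2 * Real.sqrt δ)) (by positivity) ?_
      (one_le_card_mul_pow (β := 1 / (2 * Real.sqrt δ)) hδ0 (by positivity) (by positivity) ?_ hS)
    · rw [hρ2, one_div, Real.log_inv, neg_le_neg_iff]
      have h1 : Real.log 2 ≤ Real.log (4 * δ) := Real.log_le_log two_pos (by linarith)
      nlinarith
    · intro r hr0 hr1
      rw [show 1 / (2 * Real.sqrt δ) * Real.sqrt δ = 1 / 2 by field_simp]
      nlinarith

/-- Off any null set an integrable function takes a value at most its mean. -/
theorem IsRandomizedCompressor.exists_mem {d : ℕ} {δ : ℝ} {Ω : Type*} [MeasurableSpace Ω]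
    {μ : Measure Ω} [IsProbabilityMeasure μ] {Q : Ω → Vec d → Vec d} {S : Finset (Vec d)}
    (hQ : IsRandomizedCompressor μ δ Q) (hS : ∀ v : Vec d, ‖v‖ = 1 → ∀ᵐ ω ∂μ, Q ω v ∈ S)
    (v : Vec d) (hv : ‖v‖ = 1) : ∃ s ∈ S, ‖s - v‖ ^ 2 ≤ 1 - δ := by
  obtain ⟨ω, hω, hle⟩ := exists_notMem_null_le_integral (hQ v hv).1 (ae_iff.1 (hS v hv))
  exact ⟨Q ω v, not_not.1 hω, hle.trans (hQ v hv).2⟩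

end GaussCode

theorem mainTheorem1 :
    (∀ t K : ℝ, 0 < t → 0 < K →
      -- the random codebook is a compressor with probability at least `P_δ`
      (∃ d₀ : ℕ, ∀ d : ℕ, d₀ ≤ d → ∀ δ : ℝ, GaussCode.Admissible t K d δ →
        ∀ (n : ℕ) [NeZero n],
          GaussCode.probBound d n δ t ≤
            (GaussCode.gaussianLaw d n).real
              {a | GaussCode.IsCompressor δ
                (GaussCode.quantize (GaussCode.codebook ((d : ℝ) / δ) a))}) ∧
      -- a codebook of size `exp(O(dδ))`, that is, `O(dδ)` bits, makes `P_δ` equal to `1 - o(1)`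
      (∃ C : ℝ, 0 < C ∧ ∀ η : ℝ, 0 < η → ∃ d₀ : ℕ, ∀ d : ℕ, d₀ ≤ d →
        ∀ δ : ℝ, GaussCode.Admissible t K d δ →
          (∀ n : ℕ, Real.exp (C * (d * δ)) ≤ n → 1 - η ≤ GaussCode.probBound d n δ t) ∧
          (Nat.clog 2 ⌈Real.exp (C * (d * δ))⌉₊ : ℝ) ≤ 2 * C * (d * δ))) ∧
    -- optimality: every compressor, even a randomized one, needs at least `dδ/2` bits
    (∀ (d : ℕ) (δ : ℝ), 0 ≤ δ → δ ≤ 1 →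
      ∀ (Ω : Type*) [MeasurableSpace Ω] (μ : MeasureTheory.Measure Ω)
        [MeasureTheory.IsProbabilityMeasure μ]
        (Q : Ω → GaussCode.Vec d → GaussCode.Vec d) (S : Finset (GaussCode.Vec d)),
        GaussCode.IsRandomizedCompressor μ δ Q →
        (∀ v : GaussCode.Vec d, ‖v‖ = 1 → ∀ᵐ ω ∂μ, Q ω v ∈ S) →
        d * δ / 2 ≤ Real.logb 2 S.card) := by
  refine ⟨fun t K ht hK => ⟨GaussCode.probBound_le_gaussianLaw_isCompressor ht hK,
    (2 + t) ^ 2 / 8 + 1 + K, by positivity, fun η hη => ?_⟩,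
    fun d δ hδ0 hδ1 Ω _ μ _ Q S hQ hS =>
      GaussCode.div_two_le_logb_card_of_cover hδ0 hδ1 (hQ.exists_mem hS)⟩
  obtain ⟨d₁, hd₁⟩ := GaussCode.exists_one_sub_le_probBound ht hK hη
  obtain ⟨d₂, hd₂⟩ := GaussCode.Admissible.exists_le_mul (t := t) hK 4
  refine ⟨max d₁ d₂, fun d hd δ hadm => ⟨hd₁ d (le_of_max_le_left hd) δ hadm, ?_⟩⟩
  have hX := hd₂ d (le_of_max_le_right hd) δ hadm
  rw [mul_assoc]
  refine GaussCode.clog_ceil_exp_le (hX.trans (le_mul_of_one_le_left (by linarith) ?_))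
  have := sq_nonneg (2 + t)
  linarith
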